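/- Let $H^2\subset L^2(S^1)$ be the Hardy space of the unit circle (normalised Lebesgue measure), i.e. the closed linear span of $e^{ik\theta}$, $k\ge 0$. For real $t>0$ let $$\Phi_t(e^{i\theta})=\exp\Big(t\,\frac{e^{i\theta}+1}{e^{i\theta}-1}\Big),$$ a singular inner function, let $T_{\Phi_t}\in B(H^2)$, $T_{\Phi_t}f=\Phi_t f$, be the isometric operator of multiplication by it, and let $\mathcal{T}_t\subset B(H^2)$ be the (Toeplitz) $C^*$-algebra generated by $T_{\Phi_t}$. Let $n\ge 1$ be an integer. Let $\mathbb{Q}^{(n)}$ be the additive semigroup of rational numbers generated by the numbers $\frac{m}{n^k}$, $m\in\mathbb{Z}$, $k\in\mathbb{N}$, and let $\mathbb{Q}^{(n)}_+=\mathbb{Q}_+\cap\mathbb{Q}^{(n)}$ be the semigroup of its non-negative elements. For a commutative cancellative semigroup $S$ let $C^*_{red}(S)\subset B(\ell^2(S))$ be the reduced semigroup $C^*$-algebra, generated by the isometries $\pi(a)$, $a\in S$, where $(\pi(a)f)(b)=f(c)$ if $b=a+c$ with $c\in S$, and $(\pi(a)f)(b)=0$ if there is no such $c$. **Theorem.**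 The algebras $\mathcal{T}_{1/n^k}$ are nested, $$\mathcal{T}_1\subset\mathcal{T}_{1/n}\subset\mathcal{T}_{1/n^2}\subset\cdots,$$ and the inductive limit (in the category of $C^*$-algebras and $*$-homomorphisms) of the sequence $$\mathcal{T}_1\xrightarrow{\,j\,}\mathcal{T}_{1/n}\xrightarrow{\,j\,}\mathcal{T}_{1/n^2}\xrightarrow{\,j\,}\cdots,$$ where each $j$ is the inclusion, is the $C^*$-subalgebra of $B(H^2)$ generated by $\bigcup_{k\ge0}\mathcal{T}_{1/n^k}$, together with the inclusions into it. This inductive limit is $*$-isomorphic to $C^*_{red}(\mathbb{Q}^{(n)}_+)$. -/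

import Mathlib

open MeasureTheory Filter Topology AddCircle
open scoped ENNReal NNReal Real

universe w

noncomputable section

/-! ### The Hardy space of the circle and multiplication by singular inner functions -/

instance fact_zero_lt_two_pi : Fact (0 < 2 * π) := ⟨Real.two_pi_pos⟩

/-- `L²(S¹)`: the circle is parametrised by the angle `θ ∈ ℝ / 2πℤ`, and carries its normalised
Haar measure; `fourier k` is the function `e^{ikθ}`. -/
abbrev L2Circle : Type := Lp ℂ 2 (haarAddCircle : Measure (AddCircle (2 * π)))

/-- The Hardy space `H²`: the closed subspace of `L²(S¹)` spanned by `e^{ikθ}`, `k ≥ 0`. -/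
def hardySubmodule : Submodule ℂ L2Circle :=
  (Submodule.span ℂ (Set.range fun k : ℕ => (fourierLp 2 (k : ℤ) : L2Circle))).topologicalClosure

/-- The function `z ↦ exp (t (z + 1) / (z - 1))`. -/
def singularFun (t : ℝ) (z : ℂ) : ℂ := Complex.exp (t * ((z + 1) / (z - 1)))

/-- The singular inner function `Φ_t = exp (t (e^{iθ} + 1) / (e^{iθ} - 1))` on the circle. -/
def singularInner (t : ℝ) (x : AddCircle (2 * π)) : ℂ := singularFun t (fourier 1 x)

theorem re_cayley_nonpos {z : ℂ} (hz : ‖z‖ ≤ 1) : ((z + 1) / (z - 1)).re ≤ 0 := by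
  have h1 : Complex.normSq z ≤ 1 := by
    rw [Complex.normSq_eq_norm_sq]; nlinarith [norm_nonneg z]
  rw [Complex.normSq_apply] at h1
  rw [Complex.div_re, ← add_div]
  refine div_nonpos_of_nonpos_of_nonneg ?_ (Complex.normSq_nonneg _)
  simp
  nlinarith

theorem norm_singularFun_le {t : ℝ} (ht : 0 ≤ t) {z : ℂ} (hz : ‖z‖ ≤ 1) :
    ‖singularFun t z‖ ≤ 1 := by
  rw [singularFun, Complex.norm_exp, Real.exp_le_one_iff, Complex.re_ofReal_mul]
  exact mul_nonpos_of_nonneg_of_nonpos ht (re_cayley_nonpos hz)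

theorem norm_fourier_apply (k : ℤ) (x : AddCircle (2 * π)) : ‖fourier k x‖ = 1 := by
  rw [fourier_apply]; exact Circle.norm_coe _

theorem measurable_singularInner (t : ℝ) : Measurable (singularInner t) := by
  have h : Measurable fun x : AddCircle (2 * π) => (fourier 1 x : ℂ) :=
    (fourier (T := 2 * π) 1).continuous.measurable
  unfold singularInner singularFun
  fun_prop

theorem memLp_singularInner (t : ℝ≥0) :
    MemLp (singularInner t) ∞ (haarAddCircle : Measure (AddCircle (2 * π))) :=
  memLp_top_of_bound (measurable_singularInner t).aestronglyMeasurable 1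
    (.of_forall fun x => norm_singularFun_le t.2 (norm_fourier_apply 1 x).le)

/-- The operator of multiplication by `Φ_t` on `L²(S¹)`. -/
def mulSingularInner (t : ℝ≥0) : L2Circle →L[ℂ] L2Circle :=
  (ContinuousLinearMap.mul ℂ ℂ).holderL haarAddCircle ∞ 2 2 (memLp_singularInner t).toLp

theorem coeFn_mulSingularInner (t : ℝ≥0) (f : L2Circle) :
    mulSingularInner t f =ᵐ[haarAddCircle] fun x => singularInner t x * f x := by
  filter_upwards [(ContinuousLinearMap.mul ℂ ℂ).coeFn_holder (r := 2)
    (memLp_singularInner t).toLp f, (memLp_singularInner t).coeFn_toLp] with x h1 h2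
  rw [← h2]
  exact h1

theorem differentiableOn_singularFun (t : ℝ) :
    DifferentiableOn ℂ (singularFun t) (Metric.ball 0 1) := by
  intro z hz
  have : z - 1 ≠ 0 := by
    rintro h
    rw [sub_eq_zero.1 h] at hz
    simp at hz
  unfold singularFun
  apply DifferentiableAt.differentiableWithinAt
  fun_prop (disch := assumption)

theorem fourierLp_mem_hardySubmodule (k : ℕ) :
    (fourierLp 2 (k : ℤ) : L2Circle) ∈ hardySubmodule :=
  Submodule.le_topologicalClosure _ (Submodule.subset_span ⟨k, rfl⟩)

theorem isClosed_hardySubmodule : IsClosed (hardySubmodule : Set L2Circle) :=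
  Submodule.isClosed_topologicalClosure _

theorem toLp_mem_of_hasSum {G : ℕ → C(AddCircle (2 * π), ℂ)} {g : C(AddCircle (2 * π), ℂ)}
    (h : HasSum G g)
    (hG : ∀ j, ContinuousMap.toLp (E := ℂ) 2 haarAddCircle ℂ (G j) ∈ hardySubmodule) :
    ContinuousMap.toLp (E := ℂ) 2 haarAddCircle ℂ g ∈ hardySubmodule := by
  have h' : HasSum (fun j => ContinuousMap.toLp (E := ℂ) 2 haarAddCircle ℂ (G j))
      (ContinuousMap.toLp (E := ℂ) 2 haarAddCircle ℂ g : L2Circle) :=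
    (ContinuousMap.toLp (E := ℂ) 2 (haarAddCircle (T := 2 * π)) ℂ).hasSum h
  exact isClosed_hardySubmodule.mem_of_tendsto h'
    (.of_forall fun s => Submodule.sum_mem _ fun j _ => hG j)

/-- A function `e^{ikθ} F(r e^{iθ})` with `F` holomorphic in the disc and `r < 1` lies in `H²`. -/
theorem dilate_mem_hardySubmodule {F : ℂ → ℂ} (hF : DifferentiableOn ℂ F (Metric.ball 0 1)) {r : ℝ}
    (h0 : 0 ≤ r) (h1 : r < 1) (k : ℕ) (g : C(AddCircle (2 * π), ℂ))
    (hg : ∀ x, g x = F (r * fourier 1 x) * fourier k x) :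
    ContinuousMap.toLp (E := ℂ) 2 haarAddCircle ℂ g ∈ hardySubmodule := by
  set a : ℕ → ℂ := fun j => (Nat.factorial j : ℂ)⁻¹ * iteratedDeriv j F 0 with ha
  have hser : ∀ z ∈ Metric.ball (0 : ℂ) 1, HasSum (fun j => a j * z ^ j) (F z) := by
    intro z hz
    have := Complex.hasSum_taylorSeries_on_ball (r := 1) hF (by simpa using hz)
    have he : (fun j => a j * z ^ j) =
        fun j : ℕ => (Nat.factorial j : ℂ)⁻¹ • (z - 0) ^ j • iteratedDeriv j F 0 := by
      funext j
      simp only [ha, sub_zero, smul_eq_mul]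
      ring
    rw [he]
    exact this
  have hnorm : Summable fun j => ‖a j * (r : ℂ) ^ j‖ :=
    (hser r (by simpa [abs_of_nonneg h0] using h1)).summable.norm
  set G : ℕ → C(AddCircle (2 * π), ℂ) := fun j => (a j * (r : ℂ) ^ j) • fourier ((j + k : ℕ) : ℤ)
    with hG
  have hGsum : Summable G := by
    refine Summable.of_norm ?_
    simpa only [hG, norm_smul, fourier_norm, mul_one] using hnorm
  have hGg : HasSum G g := by
    have h := hGsum.hasSum
    convert h
    ext x
    have hx : HasSum (fun j => G j x) ((∑' j, G j) x) :=
      (ContinuousMap.evalCLM ℂ x).hasSum h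
    refine HasSum.unique ?_ hx
    rw [hg]
    have hz : (r : ℂ) * fourier 1 x ∈ Metric.ball (0 : ℂ) 1 := by
      rw [mem_ball_zero_iff, norm_mul, norm_fourier_apply]
      simpa [abs_of_nonneg h0] using h1
    have he : (fun j => G j x) =
        fun j => a j * ((r : ℂ) * fourier 1 x) ^ j * fourier (k : ℤ) x := by
      funext j
      have hpow : (fourier ((j + k : ℕ) : ℤ) x : ℂ) = fourier 1 x ^ j * fourier (k : ℤ) x := by
        rw [Nat.cast_add, fourier_add, fourier_apply, fourier_apply, fourier_apply, one_smul,
          ← Circle.coe_pow, ← toCircle_nsmul, natCast_zsmul]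
      simp only [hG, ContinuousMap.smul_apply, hpow, smul_eq_mul, mul_pow]
      ring
    rw [he]
    exact (hser _ hz).mul_right (fourier (k : ℤ) x)
  exact toLp_mem_of_hasSum hGg fun j => by
    rw [hG, map_smul]
    exact Submodule.smul_mem _ _ (fourierLp_mem_hardySubmodule (j + k))

theorem ae_fourier_ne_one :
    ∀ᵐ x ∂(haarAddCircle : Measure (AddCircle (2 * π))), (fourier 1 x : ℂ) ≠ 1 := by
  have h : ∀ᵐ x ∂(haarAddCircle : Measure (AddCircle (2 * π))), x ≠ 0 := by
    have h0 : (volume : Measure (AddCircle (2 * π))) {0} = 0 := by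
      rw [← Metric.closedBall_zero, volume_closedBall]
      simp [Real.two_pi_pos.le]
    rw [volume_eq_smul_haarAddCircle] at h0
    simpa [ae_iff, Real.pi_pos.not_ge] using h0
  filter_upwards [h] with x hx h1
  refine hx (injective_toCircle (T := 2 * π) Real.two_pi_pos.ne' ?_)
  rw [fourier_one] at h1
  ext
  simpa using h1

theorem mulSingularInner_fourier_mem (t : ℝ≥0) (k : ℕ) :
    mulSingularInner t (fourierLp 2 (k : ℤ)) ∈ hardySubmodule := by
  have : CompleteSpace hardySubmodule :=
    isClosed_hardySubmodule.completeSpace_coe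
  rw [← Submodule.orthogonal_orthogonal hardySubmodule, Submodule.mem_orthogonal]
  intro u hu
  set r : ℕ → ℝ := fun m => 1 - 1 / ((m : ℝ) + 1) with hr
  have hr1 : ∀ m, r m < 1 := fun m => by
    have : (0 : ℝ) < 1 / ((m : ℝ) + 1) := by positivity
    simp only [hr]; linarith
  have hr0 : ∀ m, 0 ≤ r m := fun m => by
    simp only [hr, sub_nonneg]
    rw [div_le_one (by positivity)]
    linarith [(Nat.cast_nonneg m : (0 : ℝ) ≤ m)]
  have hrlim : Tendsto r atTop (𝓝 1) := by
    simpa [hr] using (tendsto_const_nhds (x := (1 : ℝ))).sub (tendsto_one_div_add_atTop_nhds_zero_nat (𝕜 := ℝ))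
  have hmem : ∀ m (x : AddCircle (2 * π)),
      (r m : ℂ) * fourier 1 x ∈ Metric.ball (0 : ℂ) 1 := fun m x => by
    rw [mem_ball_zero_iff, norm_mul, norm_fourier_apply]
    simpa [abs_of_nonneg (hr0 m)] using hr1 m
  have hcont : ∀ m, Continuous fun x : AddCircle (2 * π) =>
      singularFun t (r m * fourier 1 x) * fourier (k : ℤ) x := fun m =>
    ((differentiableOn_singularFun t).continuousOn.comp_continuous
      (continuous_const.mul (map_continuous (fourier 1))) (hmem m)).mul
      (map_continuous (fourier (k : ℤ)))
  set g : ℕ → C(AddCircle (2 * π), ℂ) := fun m => ⟨_, hcont m⟩ with hg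
  have hz : ∀ m, ∫ x, g m x * (starRingEnd ℂ) (u x) ∂haarAddCircle = 0 := fun m => by
    have h := (Submodule.mem_orthogonal' _ _).1 hu _
      (dilate_mem_hardySubmodule (differentiableOn_singularFun t) (hr0 m) (hr1 m) k (g m)
        fun x => rfl)
    rw [L2.inner_def] at h
    rw [← h]
    refine integral_congr_ae ?_
    filter_upwards [ContinuousMap.coeFn_toLp (p := 2) (𝕜 := ℂ) haarAddCircle (g m)] with x hx
    rw [hx]
    rfl
  have hlim : Tendsto (fun m => ∫ x, g m x * (starRingEnd ℂ) (u x) ∂haarAddCircle) atTop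
      (𝓝 (∫ x, singularInner t x * fourier (k : ℤ) x * (starRingEnd ℂ) (u x)
        ∂haarAddCircle)) := by
    refine tendsto_integral_of_dominated_convergence (fun x => ‖u x‖) (fun m => ?_) ?_
      (fun m => .of_forall fun x => ?_) ?_
    · exact (g m).continuous.aestronglyMeasurable.mul
        (RCLike.continuous_conj.comp_aestronglyMeasurable (Lp.aestronglyMeasurable u))
    · exact ((Lp.memLp u).integrable (by norm_num)).norm
    · have h1 : ‖g m x‖ ≤ 1 := by
        simp only [hg, ContinuousMap.coe_mk, norm_mul, norm_fourier_apply, mul_one]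
        exact norm_singularFun_le t.2 (mem_ball_zero_iff.1 (hmem m x)).le
      rw [norm_mul, RCLike.norm_conj]
      exact mul_le_of_le_one_left (norm_nonneg _) h1
    · filter_upwards [ae_fourier_ne_one] with x hx
      refine (Tendsto.mul_const _ ?_).mul_const _
      have hc : ContinuousAt (singularFun t) (fourier 1 x) := by
        have : (fourier 1 x : ℂ) - 1 ≠ 0 := sub_ne_zero.2 hx
        unfold singularFun
        fun_prop (disch := assumption)
      refine hc.tendsto.comp ?_
      have : Tendsto (fun m => (r m : ℂ)) atTop (𝓝 ((1 : ℝ) : ℂ)) :=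
        (Complex.continuous_ofReal.tendsto 1).comp hrlim
      simpa using this.mul_const (fourier 1 x : ℂ)
  rw [L2.inner_def]
  have h0 := tendsto_nhds_unique hlim (by simp only [hz]; exact tendsto_const_nhds)
  rw [← h0]
  refine integral_congr_ae ?_
  filter_upwards [coeFn_mulSingularInner t (fourierLp 2 (k : ℤ)), coeFn_fourierLp 2 (k : ℤ)]
    with x h1 h2
  rw [h1, h2]
  rfl

theorem mulSingularInner_mem (t : ℝ≥0) {f : L2Circle} (hf : f ∈ hardySubmodule) :
    mulSingularInner t f ∈ hardySubmodule := by
  have h : hardySubmodule ≤ hardySubmodule.comap (mulSingularInner t).toLinearMap := by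
    refine Submodule.topologicalClosure_minimal _ (Submodule.span_le.2 ?_)
      (isClosed_hardySubmodule.preimage (mulSingularInner t).continuous)
    rintro _ ⟨k, rfl⟩
    exact mulSingularInner_fourier_mem t k
  exact h hf

/-- The Hardy space `H²` as a Hilbert space. -/
def HardySpace : Type := hardySubmodule

instance : NormedAddCommGroup HardySpace := inferInstanceAs (NormedAddCommGroup hardySubmodule)

instance : InnerProductSpace ℂ HardySpace := inferInstanceAs (InnerProductSpace ℂ hardySubmodule)

instance : CompleteSpace HardySpace := isClosed_hardySubmodule.completeSpace_coe

/-- The inclusion `H² ⊆ L²(S¹)`. -/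
def HardySpace.incl : HardySpace →ₗᵢ[ℂ] L2Circle := hardySubmodule.subtypeₗᵢ

/-- The operator `T_{Φ_t} : H² → H²`, `T_{Φ_t} f = Φ_t f`. -/
def singularInnerOp (t : ℝ≥0) : HardySpace →L[ℂ] HardySpace :=
  ((mulSingularInner t).comp HardySpace.incl.toContinuousLinearMap).codRestrict hardySubmodule
    fun f => mulSingularInner_mem t f.2

theorem coeFn_singularInnerOp (t : ℝ≥0) (f : HardySpace) :
    HardySpace.incl (singularInnerOp t f) =ᵐ[haarAddCircle]
      fun x => singularInner t x * HardySpace.incl f x :=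
  coeFn_mulSingularInner t (HardySpace.incl f)

/-! ### The Toeplitz algebras and the algebra generated by their union -/

/-- The Toeplitz algebra `𝒯_t`: the `C*`-subalgebra of `B(H²)` generated by `T_{Φ_t}`. -/
def toeplitzAlgebra (t : ℝ≥0) : StarSubalgebra ℂ (HardySpace →L[ℂ] HardySpace) :=
  StarAlgebra.elemental ℂ (singularInnerOp t)

instance isClosed_toeplitzAlgebra (t : ℝ≥0) :
    IsClosed (toeplitzAlgebra t : Set (HardySpace →L[ℂ] HardySpace)) :=
  StarSubalgebra.isClosed_topologicalClosure _

/-- The `C*`-subalgebra of `B(H²)` generated by all `𝒯_{1/n^k}`, `k ≥ 0`; when these algebras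
are nested it is the norm closure of their union. -/
def toeplitzTowerAlgebra (n : ℕ) : StarSubalgebra ℂ (HardySpace →L[ℂ] HardySpace) :=
  (⨆ k : ℕ, toeplitzAlgebra (1 / (n : ℝ≥0) ^ k)).topologicalClosure

instance isClosed_toeplitzTowerAlgebra (n : ℕ) :
    IsClosed (toeplitzTowerAlgebra n : Set (HardySpace →L[ℂ] HardySpace)) :=
  StarSubalgebra.isClosed_topologicalClosure _

theorem toeplitzAlgebra_le_tower (n k : ℕ) :
    toeplitzAlgebra (1 / (n : ℝ≥0) ^ k) ≤ toeplitzTowerAlgebra n :=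
  (le_iSup (fun k : ℕ => toeplitzAlgebra (1 / (n : ℝ≥0) ^ k)) k).trans
    (StarSubalgebra.le_topologicalClosure _)

/-! ### Inductive limits of sequences of `C*`-algebras -/

/-- `L` with the maps `ι k : A k → L` is the inductive limit, in the category of `C*`-algebras and
`*`-homomorphisms, of the sequence `A 0 → A 1 → A 2 → ⋯` with connecting maps `j k`. -/
def IsInductiveLimit.{u₁, u₂, u₃} {A : ℕ → Type u₁} [∀ k, NonUnitalCStarAlgebra (A k)]
    (j : ∀ k, A k →⋆ₙₐ[ℂ] A (k + 1)) {L : Type u₂} [NonUnitalCStarAlgebra L]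
    (ι : ∀ k, A k →⋆ₙₐ[ℂ] L) : Prop :=
  (∀ k, (ι (k + 1)).comp (j k) = ι k) ∧
    ∀ (B : Type u₃) [NonUnitalCStarAlgebra B] (ψ : ∀ k, A k →⋆ₙₐ[ℂ] B),
      (∀ k, (ψ (k + 1)).comp (j k) = ψ k) →
        ∃! Ψ : L →⋆ₙₐ[ℂ] B, ∀ k, Ψ.comp (ι k) = ψ k

/-! ### The reduced semigroup `C*`-algebra -/

section Reduced

variable {S : Type*} [AddCommMonoid S] [IsCancelAdd S]

theorem hasSum_extend_add (a : S) (f : lp (fun _ : S => ℂ) 2) :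
    HasSum (fun b => ‖Function.extend (fun c => a + c) f 0 b‖ ^ (2 : ℝ)) (‖f‖ ^ (2 : ℝ)) := by
  have h := lp.hasSum_norm (p := 2) (by norm_num) f
  have hinj : Function.Injective fun c : S => a + c := add_right_injective a
  rw [ENNReal.toReal_ofNat] at h
  refine (hinj.hasSum_iff ?_).1 ?_
  · intro b hb
    rw [Function.extend_apply' _ _ _ hb]
    simp
  · convert h using 2 with c
    simp [hinj.extend_apply]

/-- The regular isometric representation of a cancellative commutative semigroup on `ℓ²(S)`:
`(π(a) f)(b) = f(c)` if `b = a + c` for some `c ∈ S`, and `(π(a) f)(b) = 0` otherwise. -/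
def regularRep (a : S) : lp (fun _ : S => ℂ) 2 →L[ℂ] lp (fun _ : S => ℂ) 2 :=
  LinearIsometry.toContinuousLinearMap
    { toFun := fun f => ⟨Function.extend (fun c => a + c) f 0,
        memℓp_gen (by simpa using (hasSum_extend_add a f).summable)⟩
      map_add' := fun f g => by
        ext b
        by_cases hb : ∃ c, a + c = b
        · obtain ⟨c, rfl⟩ := hb
          simp only [lp.coeFn_add, Pi.add_apply, (add_right_injective a).extend_apply]
        · simp only [lp.coeFn_add, Pi.add_apply, Function.extend_apply' _ _ _ hb, Pi.zero_apply,
            add_zero]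
      map_smul' := fun z f => by
        ext b
        by_cases hb : ∃ c, a + c = b
        · obtain ⟨c, rfl⟩ := hb
          simp [(add_right_injective a).extend_apply]
        · simp [Function.extend_apply' _ _ _ hb]
      norm_map' := fun f => by
        have h2 : (0 : ℝ) < (2 : ℝ≥0∞).toReal := by norm_num
        rw [lp.norm_eq_tsum_rpow h2]
        simp only [ENNReal.toReal_ofNat]
        exact (congrArg (· ^ (1 / (2 : ℝ))) (hasSum_extend_add a f).tsum_eq).trans (by
          simp only [← Real.rpow_mul (norm_nonneg f)]
          norm_num) }

theorem regularRep_apply_add (a c : S) (f : lp (fun _ : S => ℂ) 2) :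
    regularRep a f (a + c) = f c :=
  (add_right_injective a).extend_apply _ _ c

theorem regularRep_apply_of_forall_ne (a b : S) (hb : ¬∃ c, a + c = b)
    (f : lp (fun _ : S => ℂ) 2) : regularRep a f b = 0 :=
  Function.extend_apply' _ _ _ hb

variable (S) in
/-- The reduced semigroup `C*`-algebra `C*_red(S)`: the `C*`-subalgebra of `B(ℓ²(S))` generated by
the operators of the regular isometric representation. -/
def reducedCStarAlgebra :
    StarSubalgebra ℂ (lp (fun _ : S => ℂ) 2 →L[ℂ] lp (fun _ : S => ℂ) 2) :=
  (StarAlgebra.adjoin ℂ (Set.range (regularRep (S := S)))).topologicalClosure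

variable (S) in
theorem isClosed_reducedCStarAlgebra :
    IsClosed (reducedCStarAlgebra S :
      Set (lp (fun _ : S => ℂ) 2 →L[ℂ] lp (fun _ : S => ℂ) 2)) :=
  StarSubalgebra.isClosed_topologicalClosure _

end Reduced

/-- The semigroup `ℚ^(n)` of rational numbers generated by the numbers `m / n^k`, with `m ∈ ℤ` and
`k ∈ ℕ`. -/
def nAdicRationals (n : ℕ) : AddSubmonoid ℚ :=
  AddSubmonoid.closure {q | ∃ (m : ℤ) (k : ℕ), q = (m : ℚ) / (n : ℚ) ^ k}

/-- `ℚ^(n)_+ = ℚ_+ ∩ ℚ^(n)`, where `ℚ_+` is the semigroup of non-negative rationals. -/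
def nAdicNonneg (n : ℕ) : AddSubmonoid ℚ := AddSubmonoid.nonneg ℚ ⊓ nAdicRationals n

end

/-!
The proof compares isometries one at a time, by Coburn's theorem, and passes to the limit.

*Nesting.* Since `Φ_{s+t} = Φ_s Φ_t`, the generator of `𝒯_{1/n^k}` is the `n`-th power of the
generator of `𝒯_{1/n^(k+1)}`. The same relation holds between `π(1/n^k)` and `π(1/n^(k+1))`, and
`1/n^k`, `k ≥ 0`, generate the semigroup `ℚ^(n)_+`. So both algebras of the theorem are closures of
increasing unions of algebras generated by a single isometry.

*Coburn's theorem.* Let `V` be a pure isometry (`(V*)^j → 0` strongly) and `V'` an isometry with a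
unit vector `e'` in `ker V'*`. The translates `V^j e_i` of a Hilbert basis `(e_i)` of `ker V*` form a
Hilbert basis (`exists_parseval_of_pure`). Each `e_i`, like `e'`, spans a copy of the unilateral
shift, and matching these copies gives operators `W_i` that satisfy `W_i p(V, V*) = p(V', V'*) W_i`
for every noncommutative polynomial `p`, while `∑ ‖W_i x‖² = ‖x‖²`. Hence
`‖p(V, V*)‖ ≤ ‖p(V', V'*)‖` (`norm_fst_le_norm_snd_of_mem_adjoin`), and equality holds when `V'` is
pure and `ker V* ≠ 0` as well. The pairs `(p(V, V*), p(V', V'*))` are handled as the elements of the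
`*`-subalgebra generated by `(V, V')` in the product of the two operator algebras.

*The hypotheses.* For `π(a)` on `ℓ²(ℚ^(n)_+)`, `a > 0`, the vector `δ_0` lies in the kernel of the
adjoint, and `π(a)` is pure by the Archimedean property. For `T_{Φ_t}`, `t > 0`, the Fourier
coefficients of `Φ_t` vanish at negative indices, and the one at `0` is `Φ_t(0) = e^{-t}` by the mean
value property. So the adjoint is upper triangular in the basis `e^{ikθ}` with diagonal entries
`e^{-t} < 1`; this makes its powers tend to `0` on each basis vector
(`tendsto_star_singularInnerOp_pow`), and shows that `T_{Φ_t}` is not unitary.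

*Passing to the limit.* A `*`-subalgebra of `A × B` whose elements satisfy `‖b‖ ≤ ‖a‖`, and whose
first coordinates are dense in `A`, lies in the graph of a `*`-homomorphism `A → B`
(`exists_starHom_of_graph`). This gives the isomorphism with the reduced semigroup algebra, and also
the universal property of the closure of the union of the `𝒯_{1/n^k}`, because `*`-homomorphisms
between `C*`-algebras are contractive.
-/

/-! ### Homomorphisms of `C*`-algebras given by a graph -/

section Graph

variable {A B : Type*} [NonUnitalCStarAlgebra A] [NonUnitalCStarAlgebra B]

/-- A `*`-subalgebra of `A × B` on which the second coordinate is dominated by the first is part of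
the graph of a `*`-homomorphism, provided its first coordinates are dense: its closure is the
graph. -/
theorem exists_starHom_of_graph (U : NonUnitalStarSubalgebra ℂ (A × B))
    (hU : ∀ x ∈ U, ‖x.2‖ ≤ ‖x.1‖) (hd : ∀ a : A, a ∈ closure (Prod.fst '' (U : Set (A × B)))) :
    ∃ Φ : A →⋆ₙₐ[ℂ] B, ∀ x ∈ U, Φ x.1 = x.2 := by
  set V := U.topologicalClosure with hV
  have hVn : ∀ x ∈ V, ‖x.2‖ ≤ ‖x.1‖ := by
    intro x hx
    have hc : IsClosed {x : A × B | ‖x.2‖ ≤ ‖x.1‖} :=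
      isClosed_le (by fun_prop) (by fun_prop)
    exact closure_minimal (show (U : Set (A × B)) ⊆ _ from hU) hc hx
  have hex : ∀ a : A, ∃ b : B, (a, b) ∈ V := by
    intro a
    obtain ⟨u, hu, hlim⟩ := mem_closure_iff_seq_limit.1 (hd a)
    choose x hxU hx using hu
    have hcs : CauchySeq fun m => (x m).2 := by
      have hc1 : CauchySeq u := hlim.cauchySeq
      rw [Metric.cauchySeq_iff] at hc1 ⊢
      intro ε hε
      obtain ⟨N, hN⟩ := hc1 ε hε
      refine ⟨N, fun m hm k hk => lt_of_le_of_lt ?_ (hN m hm k hk)⟩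
      rw [dist_eq_norm, dist_eq_norm, ← hx m, ← hx k]
      exact hU _ (sub_mem (hxU m) (hxU k))
    obtain ⟨b, hb⟩ := cauchySeq_tendsto_of_complete hcs
    refine ⟨b, mem_closure_of_tendsto (hlim.prodMk_nhds hb) (.of_forall fun m => ?_)⟩
    rw [← hx m]
    exact hxU m
  choose Φ hΦ using hex
  have huniq : ∀ {a b}, (a, b) ∈ V → Φ a = b := by
    intro a b hab
    have h := hVn _ (sub_mem (hΦ a) hab)
    simpa [sub_eq_zero] using h
  refine ⟨⟨⟨⟨⟨Φ, fun c a => ?_⟩, ?_, fun a b => ?_⟩, fun a b => ?_⟩, fun a => ?_⟩, fun x hx => ?_⟩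
  · exact huniq (SMulMemClass.smul_mem c (hΦ a))
  · exact huniq (zero_mem V)
  · exact huniq (add_mem (hΦ a) (hΦ b))
  · exact huniq (mul_mem (hΦ a) (hΦ b))
  · exact huniq (star_mem (hΦ a))
  · exact huniq (NonUnitalStarSubalgebra.le_topologicalClosure U hx)

open scoped CStarAlgebra in
theorem starHom_eq_of_dense {D : Set A} (hD : ∀ a : A, a ∈ closure D) {Φ Ψ : A →⋆ₙₐ[ℂ] B}
    (h : ∀ a ∈ D, Φ a = Ψ a) : Φ = Ψ := by
  ext a
  have hc : IsClosed {a : A | Φ a = Ψ a} := isClosed_eq (map_continuous Φ) (map_continuous Ψ)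
  exact closure_minimal (show D ⊆ _ from h) hc (hD a)

theorem nonempty_starAlgEquiv_of_graph (U : NonUnitalStarSubalgebra ℂ (A × B))
    (hU : ∀ x ∈ U, ‖x.2‖ = ‖x.1‖) (hA : ∀ a : A, a ∈ closure (Prod.fst '' (U : Set (A × B))))
    (hB : ∀ b : B, b ∈ closure (Prod.snd '' (U : Set (A × B)))) : Nonempty (A ≃⋆ₐ[ℂ] B) := by
  obtain ⟨Φ, hΦ⟩ := exists_starHom_of_graph U (fun x hx => (hU x hx).le) hA
  -- The inverse comes from the same subalgebra with the coordinates exchanged.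
  obtain ⟨Ψ, hΨ⟩ := exists_starHom_of_graph
    (U.comap ((NonUnitalStarAlgHom.snd ℂ B A).prod (NonUnitalStarAlgHom.fst ℂ B A)))
    (fun x hx => (hU _ hx).ge) fun b => by
      refine closure_mono ?_ (hB b)
      rintro _ ⟨x, hx, rfl⟩
      exact ⟨x.swap, hx, rfl⟩
  have h1 : Ψ.comp Φ = NonUnitalStarAlgHom.id ℂ A := by
    refine starHom_eq_of_dense hA ?_
    rintro _ ⟨x, hx, rfl⟩
    rw [NonUnitalStarAlgHom.comp_apply, hΦ x hx]
    exact hΨ x.swap hx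
  have h2 : Φ.comp Ψ = NonUnitalStarAlgHom.id ℂ B := by
    refine starHom_eq_of_dense hB ?_
    rintro _ ⟨x, hx, rfl⟩
    rw [NonUnitalStarAlgHom.comp_apply, show Ψ x.2 = x.1 from hΨ x.swap hx]
    exact hΦ x hx
  exact ⟨{ toFun := Φ
           invFun := Ψ
           left_inv := fun a => DFunLike.congr_fun h1 a
           right_inv := fun b => DFunLike.congr_fun h2 b
           map_mul' := map_mul Φ
           map_add' := map_add Φ
           map_star' := map_star Φ
           map_smul' := map_smul Φ }⟩

end Graph

/-- An increasing sequence of `C*`-algebras embedded with dense union in `L` has `L` as its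
inductive limit. -/
theorem isInductiveLimit_of_dense.{u₁, u₂, u₃} {A : ℕ → Type u₁}
    [∀ k, NonUnitalCStarAlgebra (A k)] (j : ∀ k, A k →⋆ₙₐ[ℂ] A (k + 1)) {L : Type u₂}
    [NonUnitalCStarAlgebra L] (ι : ∀ k, A k →⋆ₙₐ[ℂ] L) (hι : ∀ k, Function.Injective (ι k))
    (hj : ∀ k, (ι (k + 1)).comp (j k) = ι k) (hd : ∀ x : L, x ∈ closure (⋃ k, Set.range (ι k))) :
    IsInductiveLimit.{u₁, u₂, u₃} j ι := by
  refine ⟨hj, fun B _ ψ hψ => ?_⟩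
  -- The graphs of `ψ k ∘ (ι k)⁻¹` increase with `k`, and their union is a graph.
  let G : ℕ → NonUnitalStarSubalgebra ℂ (L × B) := fun k =>
    NonUnitalStarAlgHom.range ((ι k).prod (ψ k))
  have hG : Monotone G := by
    refine monotone_nat_of_le_succ fun k => ?_
    rintro _ ⟨a, rfl⟩
    refine ⟨j k a, Prod.ext ?_ ?_⟩
    · exact DFunLike.congr_fun (hj k) a
    · exact DFunLike.congr_fun (hψ k) a
  have hmem : ∀ x : L × B, x ∈ ⨆ k, G k ↔ ∃ k, x ∈ G k := fun x => by
    rw [← SetLike.mem_coe, NonUnitalStarSubalgebra.coe_iSup_of_directed hG.directed_le]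
    simp
  have hn : ∀ x ∈ ⨆ k, G k, ‖x.2‖ ≤ ‖x.1‖ := by
    intro x hx
    obtain ⟨k, a, rfl⟩ := (hmem x).1 hx
    exact (NonUnitalStarAlgHom.norm_apply_le (ψ k) a).trans
      (NonUnitalStarAlgHom.norm_map (ι k) (hι k) a).ge
  obtain ⟨Ψ, hΨ⟩ := exists_starHom_of_graph (⨆ k, G k) hn fun x => by
    refine closure_mono ?_ (hd x)
    refine Set.iUnion_subset fun k => ?_
    rintro _ ⟨a, rfl⟩
    exact ⟨(ι k a, ψ k a), (hmem _).2 ⟨k, a, rfl⟩, rfl⟩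
  have hΨι : ∀ k, Ψ.comp (ι k) = ψ k := fun k => by
    ext a
    exact hΨ (ι k a, ψ k a) ((hmem _).2 ⟨k, a, rfl⟩)
  refine ⟨Ψ, hΨι, fun Ψ' hΨ' => starHom_eq_of_dense hd ?_⟩
  intro x hx
  obtain ⟨k, a, rfl⟩ := Set.mem_iUnion.1 hx
  exact DFunLike.congr_fun ((hΨ' k).trans (hΨι k).symm) a

/-! ### The regular representation on basis vectors -/

section Regular

variable {S : Type*} [AddCommMonoid S] [IsCancelAdd S]

theorem regularRep_single [DecidableEq S] (a b : S) (c : ℂ) :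
    regularRep a (lp.single 2 b c) = lp.single 2 (a + b) c := by
  ext d
  by_cases hd : ∃ x, a + x = d
  · obtain ⟨x, rfl⟩ := hd
    rw [regularRep_apply_add, lp.single_apply, lp.single_apply]
    simp [Pi.single_apply]
  · rw [regularRep_apply_of_forall_ne a d hd, lp.single_apply,
      Pi.single_eq_of_ne fun h => hd ⟨b, h.symm⟩]

theorem star_regularRep_apply (a b : S) (f : lp (fun _ : S => ℂ) 2) :
    (star (regularRep a) f : lp (fun _ : S => ℂ) 2) b = f (a + b) := by
  classical
  have h : inner ℂ (lp.single 2 b (1 : ℂ)) (star (regularRep a) f) =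
      inner ℂ (lp.single 2 (a + b) (1 : ℂ)) f := by
    rw [ContinuousLinearMap.star_eq_adjoint, ContinuousLinearMap.adjoint_inner_right,
      regularRep_single]
  simpa [lp.inner_single_left] using h

theorem regularRep_zero : regularRep (0 : S) = 1 := by
  ext f d
  have := regularRep_apply_add 0 d f
  rwa [zero_add] at this

theorem regularRep_add (a b : S) : regularRep (a + b) = regularRep a * regularRep b := by
  ext f d
  rw [mul_apply_eq_comp]
  by_cases h : ∃ c, a + c = d
  · obtain ⟨c, rfl⟩ := h
    rw [regularRep_apply_add]
    by_cases h' : ∃ x, b + x = c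
    · obtain ⟨x, rfl⟩ := h'
      rw [regularRep_apply_add, ← add_assoc, regularRep_apply_add]
    · rw [regularRep_apply_of_forall_ne b c h', regularRep_apply_of_forall_ne]
      rintro ⟨x, hx⟩
      exact h' ⟨x, add_left_cancel (a := a) (by rw [← hx, add_assoc])⟩
  · rw [regularRep_apply_of_forall_ne a d h, regularRep_apply_of_forall_ne]
    rintro ⟨x, hx⟩
    exact h ⟨b + x, by rw [← hx, add_assoc]⟩

theorem regularRep_nsmul (m : ℕ) (a : S) : regularRep (m • a) = regularRep a ^ m := by
  induction m with
  | zero => rw [zero_nsmul, pow_zero, regularRep_zero]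
  | succ m ih => rw [succ_nsmul, pow_succ, regularRep_add, ih]

theorem star_regularRep_mul_self (a : S) : star (regularRep a) * regularRep a = 1 := by
  classical
  ext f d
  rw [mul_apply_eq_comp, star_regularRep_apply, regularRep_apply_add]
  rfl

end Regular

/-! ### Pure isometries -/

section Isometry

variable {H G : Type*} [NormedAddCommGroup H] [InnerProductSpace ℂ H] [CompleteSpace H]
  [NormedAddCommGroup G] [InnerProductSpace ℂ G] [CompleteSpace G]

theorem inner_apply_right_eq (V : H →L[ℂ] H) (x y : H) :
    inner ℂ x (V y) = inner ℂ (star V x) y := by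
  rw [ContinuousLinearMap.star_eq_adjoint, ContinuousLinearMap.adjoint_inner_left]

theorem star_pow_mul_pow {V : H →L[ℂ] H} (hV : star V * V = 1) (j : ℕ) :
    star (V ^ j) * V ^ j = 1 := by
  induction j with
  | zero => simp
  | succ j ih =>
    rw [pow_succ', star_mul, mul_assoc, ← mul_assoc (star V), hV, one_mul, ih]

/-- The translates under an isometry `V` of an orthonormal family in `ker V*` are orthonormal. -/
theorem orthonormal_pow_apply {V : H →L[ℂ] H} (hV : star V * V = 1) {ι : Type*} {e : ι → H}
    (he : Orthonormal ℂ e) (hk : ∀ i, star V (e i) = 0) :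
    Orthonormal ℂ fun p : ι × ℕ => (V ^ p.2) (e p.1) := by
  classical
  have hlt : ∀ (j m : ℕ) (i l : ι),
      inner ℂ ((V ^ j) (e i)) ((V ^ (j + (m + 1))) (e l)) = 0 := by
    intro j m i l
    rw [inner_apply_right_eq, pow_add, star_mul, mul_apply_eq_comp,
      ← mul_apply_eq_comp (star (V ^ j)), star_pow_mul_pow hV, pow_succ', star_mul,
      mul_apply_eq_comp, one_apply_eq_self, hk, map_zero, inner_zero_left]
  rw [orthonormal_iff_ite] at he ⊢
  rintro ⟨i, j⟩ ⟨l, k⟩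
  dsimp only
  rcases lt_trichotomy j k with h | h | h
  · obtain ⟨m, rfl⟩ := Nat.exists_eq_add_of_lt h
    rw [add_assoc, hlt, if_neg]
    simp [Prod.ext_iff]
  · subst h
    rw [inner_apply_right_eq, ← mul_apply_eq_comp, star_pow_mul_pow hV,
      one_apply_eq_self, he]
    simp [Prod.ext_iff]
  · obtain ⟨m, rfl⟩ := Nat.exists_eq_add_of_lt h
    rw [← inner_conj_symm, add_assoc, hlt, if_neg, map_zero]
    simp [Prod.ext_iff]

/-- A unit vector `e` with `V* e = 0` gives a copy of the unilateral shift inside `V`, on a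
subspace that reduces `V`. -/
theorem exists_shift_intertwiner {V : H →L[ℂ] H} (hV : star V * V = 1) {e : H} (he : ‖e‖ = 1)
    (hk : star V e = 0) :
    ∃ U : lp (fun _ : ℕ => ℂ) 2 →ₗᵢ[ℂ] H,
      (∀ j, U (lp.single 2 j 1) = (V ^ j) e) ∧
      V ∘L U.toContinuousLinearMap = U.toContinuousLinearMap ∘L regularRep (1 : ℕ) ∧
      star V ∘L U.toContinuousLinearMap =
        U.toContinuousLinearMap ∘L star (regularRep (1 : ℕ)) := by
  have ho : Orthonormal ℂ fun j : ℕ => (V ^ j) e := by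
    have h1 : Orthonormal ℂ fun _ : Unit => e :=
      ⟨fun _ => he, fun i j hij => (hij rfl).elim⟩
    exact (orthonormal_pow_apply hV h1 fun _ => hk).comp (fun j : ℕ => ((), j))
      fun a b h => congrArg Prod.snd h
  set U := ho.orthogonalFamily.linearIsometry with hU
  have hs : ∀ (j : ℕ) (c : ℂ), U (lp.single 2 j c) = c • (V ^ j) e := fun j c => by
    rw [hU, ho.orthogonalFamily.linearIsometry_apply_single]
    rfl
  have hs0 : star (regularRep (1 : ℕ)) (lp.single 2 0 1) = 0 := by
    ext b
    rw [star_regularRep_apply, lp.single_apply_ne _ _ _ (by omega)]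
    rfl
  have hsS : ∀ j, star (regularRep (1 : ℕ)) (lp.single 2 (j + 1) 1) = lp.single 2 j (1 : ℂ) := by
    intro j
    rw [add_comm j 1, ← regularRep_single, ← mul_apply_eq_comp,
      star_regularRep_mul_self]
    rfl
  refine ⟨U, fun j => by rw [hs, one_smul], ?_, ?_⟩
  · refine lp.ext_continuousLinearMap (by norm_num) fun j => ?_
    ext
    simp [hs, regularRep_single, add_comm 1 j, pow_succ']
  · refine lp.ext_continuousLinearMap (by norm_num) fun j => ?_
    ext
    rcases j with _ | j
    · simp [hs, hs0, hk]
    · simp only [ContinuousLinearMap.comp_apply, lp.singleContinuousLinearMap_apply,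
        LinearIsometry.coe_toContinuousLinearMap, hs, hsS, one_smul]
      rw [pow_succ', mul_apply_eq_comp, ← mul_apply_eq_comp (star V), hV]
      rfl

/-- For a pure isometry `V`, the translates of a Hilbert basis of `ker V*` form a Hilbert basis
(the Wold decomposition), hence Parseval's identity. -/
theorem exists_parseval_of_pure {V : H →L[ℂ] H} (hV : star V * V = 1)
    (hp : ∀ x, Tendsto (fun j : ℕ => (star V ^ j) x) atTop (𝓝 0)) :
    ∃ (ι : Set (LinearMap.ker (star V).toLinearMap)) (e : ι → H), (∀ i, ‖e i‖ = 1) ∧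
      (∀ i, star V (e i) = 0) ∧
      ∀ x, HasSum (fun p : ι × ℕ => ‖inner ℂ ((V ^ p.2) (e p.1)) x‖ ^ 2) (‖x‖ ^ 2) := by
  have hcl : IsClosed (LinearMap.ker (star V).toLinearMap : Set H) :=
    ContinuousLinearMap.isClosed_ker (star V)
  have : CompleteSpace (LinearMap.ker (star V).toLinearMap) := hcl.completeSpace_coe
  obtain ⟨ι, b, -⟩ := exists_hilbertBasis ℂ (LinearMap.ker (star V).toLinearMap)
  set e : ι → H := fun i => (b i : H) with hedef
  have heo : Orthonormal ℂ e := b.orthonormal.comp_linearIsometry (Submodule.subtypeₗᵢ _)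
  have hk : ∀ i, star V (e i) = 0 := fun i => (b i).2
  have ho := orthonormal_pow_apply hV heo hk
  refine ⟨ι, e, heo.1, hk, ?_⟩
  have hsp : (Submodule.span ℂ (Set.range fun p : ι × ℕ => (V ^ p.2) (e p.1)))ᗮ = ⊥ := by
    rw [eq_bot_iff]
    intro x hx
    rw [Submodule.mem_orthogonal] at hx
    -- `(V*)^j x` is orthogonal to `ker V*`, so `V V*` fixes it.
    have h1 : ∀ j, V (star V ((star V ^ j) x)) = (star V ^ j) x := by
      intro j
      set y := (star V ^ j) x with hy
      have hmem : y - V (star V y) ∈ LinearMap.ker (star V).toLinearMap := by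
        rw [LinearMap.mem_ker, ContinuousLinearMap.coe_coe, map_sub,
          ← mul_apply_eq_comp (star V) V, hV, one_apply_eq_self, sub_self]
      have h0 : (⟨_, hmem⟩ : LinearMap.ker (star V).toLinearMap) = 0 := by
        refine b.repr.injective ?_
        ext i
        rw [b.repr_apply_apply, map_zero, Submodule.coe_inner]
        have hxe : inner ℂ (e i) y = 0 := by
          have := hx _ (Submodule.subset_span ⟨(i, j), rfl⟩)
          rw [hy, ← star_pow, inner_apply_right_eq, star_star]
          exact this
        rw [inner_sub_right, inner_apply_right_eq V]
        change inner ℂ (e i) y - inner ℂ (star V (e i)) _ = _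
        rw [hxe, hk, inner_zero_left, sub_zero]
        rfl
      exact (sub_eq_zero.1 (congrArg Subtype.val h0)).symm
    -- So `V*` preserves the norms along the orbit of `x`, while purity makes them tend to `0`.
    have h2 : ∀ j, ‖(star V ^ j) x‖ = ‖x‖ := by
      intro j
      induction j with
      | zero => simp
      | succ j ih =>
        rw [← ih, pow_succ', mul_apply_eq_comp]
        conv_rhs => rw [← h1 j]
        exact ((ContinuousLinearMap.norm_map_iff_adjoint_comp_self V).2 hV _).symm
    have h3 := (hp x).norm
    simp only [h2, norm_zero] at h3
    exact norm_eq_zero.1 (tendsto_nhds_unique tendsto_const_nhds h3)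
  intro x
  set B := HilbertBasis.mkOfOrthogonalEqBot ho hsp with hB
  have h := B.hasSum_inner_mul_inner x x
  rw [inner_self_eq_norm_sq_to_K] at h
  have h' : HasSum (fun p : ι × ℕ => ((‖inner ℂ ((V ^ p.2) (e p.1)) x‖ ^ 2 : ℝ) : ℂ))
      ((‖x‖ ^ 2 : ℝ) : ℂ) := by
    rw [Complex.ofReal_pow]
    refine Eq.mp (congrArg (fun f => HasSum f _) (funext fun p => ?_)) h
    rw [hB, HilbertBasis.coe_mkOfOrthogonalEqBot, ← inner_conj_symm, RCLike.conj_mul]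
    exact (Complex.ofReal_pow _ _).symm
  exact_mod_cast h'

/-- Coburn's comparison: `‖p(V, V*)‖ ≤ ‖p(V', V'*)‖` for every noncommutative polynomial `p`, if
`V` is a pure isometry and `V'` is an isometry that is not unitary. -/
theorem norm_fst_le_norm_snd_of_mem_adjoin {V : H →L[ℂ] H} (hV : star V * V = 1)
    (hp : ∀ x, Tendsto (fun j : ℕ => (star V ^ j) x) atTop (𝓝 0)) {V' : G →L[ℂ] G}
    (hV' : star V' * V' = 1) {e' : G} (he' : ‖e'‖ = 1) (hk' : star V' e' = 0)
    {x : (H →L[ℂ] H) × (G →L[ℂ] G)} (hx : x ∈ StarAlgebra.adjoin ℂ {(V, V')}) :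
    ‖x.1‖ ≤ ‖x.2‖ := by
  obtain ⟨ι, e, he, hk, hpars⟩ := exists_parseval_of_pure hV hp
  choose U hUs hU hU' using fun i => exists_shift_intertwiner hV (he i) (hk i)
  obtain ⟨U', -, hW, hW'⟩ := exists_shift_intertwiner hV' he' hk'
  -- `W i` carries the copy of the shift generated by `e i` onto the one generated by `e'`.
  set W : ι → H →L[ℂ] G := fun i =>
    U'.toContinuousLinearMap ∘L (U i).toContinuousLinearMap.adjoint with hWdef
  have hadj : ∀ i, (U i).toContinuousLinearMap.adjoint ∘L V =
      regularRep (1 : ℕ) ∘L (U i).toContinuousLinearMap.adjoint := fun i => by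
    have := congrArg ContinuousLinearMap.adjoint (hU' i)
    simpa [ContinuousLinearMap.adjoint_comp, ContinuousLinearMap.star_eq_adjoint] using this
  have hadj' : ∀ i, (U i).toContinuousLinearMap.adjoint ∘L star V =
      star (regularRep (1 : ℕ)) ∘L (U i).toContinuousLinearMap.adjoint := fun i => by
    have := congrArg ContinuousLinearMap.adjoint (hU i)
    simpa [ContinuousLinearMap.adjoint_comp, ContinuousLinearMap.star_eq_adjoint] using this
  -- The intertwining relation passes to products and adjoints once it is required of `x` and `x*`.
  have hWx : ∀ i, W i ∘L x.1 = x.2 ∘L W i ∧ W i ∘L star x.1 = star x.2 ∘L W i := by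
    intro i
    induction hx using StarAlgebra.adjoin_induction with
    | mem x hx =>
      rw [Set.mem_singleton_iff.1 hx]
      simp only [hWdef]
      constructor
      · rw [ContinuousLinearMap.comp_assoc, hadj, ← ContinuousLinearMap.comp_assoc, ← hW,
          ContinuousLinearMap.comp_assoc]
      · rw [ContinuousLinearMap.comp_assoc, hadj', ← ContinuousLinearMap.comp_assoc, ← hW',
          ContinuousLinearMap.comp_assoc]
    | algebraMap r =>
      constructor <;>
      · ext y
        simp [Algebra.algebraMap_eq_smul_one]
    | add x y _ _ hx hy =>
      constructor
      · rw [Prod.fst_add, Prod.snd_add, ContinuousLinearMap.comp_add, hx.1, hy.1,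
          ContinuousLinearMap.add_comp]
      · rw [Prod.fst_add, Prod.snd_add, star_add, star_add, ContinuousLinearMap.comp_add, hx.2,
          hy.2, ContinuousLinearMap.add_comp]
    | mul x y _ _ hx hy =>
      constructor
      · rw [Prod.fst_mul, Prod.snd_mul, ContinuousLinearMap.mul_def, ContinuousLinearMap.mul_def,
          ← ContinuousLinearMap.comp_assoc, hx.1, ContinuousLinearMap.comp_assoc, hy.1,
          ContinuousLinearMap.comp_assoc]
      · rw [Prod.fst_mul, Prod.snd_mul, star_mul, star_mul, ContinuousLinearMap.mul_def,
          ContinuousLinearMap.mul_def, ← ContinuousLinearMap.comp_assoc, hy.2,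
          ContinuousLinearMap.comp_assoc, hx.2, ContinuousLinearMap.comp_assoc]
    | star x _ hx =>
      rw [Prod.fst_star, Prod.snd_star, star_star, star_star]
      exact hx.symm
  have hsum : ∀ y : H, HasSum (fun i => ‖W i y‖ ^ 2) (‖y‖ ^ 2) := by
    intro y
    refine (hpars y).prod_fiberwise fun i => ?_
    have hn : ‖W i y‖ = ‖(U i).toContinuousLinearMap.adjoint y‖ := U'.norm_map _
    have h := lp.hasSum_norm (p := 2) (by norm_num) ((U i).toContinuousLinearMap.adjoint y)
    rw [hn]
    simp only [ENNReal.toReal_ofNat, Real.rpow_ofNat] at h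
    refine Eq.mp (congrArg (fun f => HasSum f _) (funext fun j => ?_)) h
    have hj : inner ℂ (lp.single 2 j (1 : ℂ)) ((U i).toContinuousLinearMap.adjoint y) =
        inner ℂ ((V ^ j) (e i)) y := by
      rw [ContinuousLinearMap.adjoint_inner_right]
      simp [hUs]
    rw [← hj, lp.inner_single_left]
    simp
  refine ContinuousLinearMap.opNorm_le_bound _ (norm_nonneg _) fun y => ?_
  refine le_of_sq_le_sq ?_ (by positivity)
  rw [mul_pow]
  refine hasSum_le (fun i => ?_) (hsum (x.1 y)) ((hsum y).mul_left (‖x.2‖ ^ 2))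
  have h : W i (x.1 y) = x.2 (W i y) := DFunLike.congr_fun (hWx i).1 y
  rw [h, ← mul_pow]
  exact pow_le_pow_left₀ (norm_nonneg _) (x.2.le_opNorm _) 2

end Isometry

/-! ### Vectors on which the powers of a contraction tend to zero -/

section Stable

variable {H : Type*} [NormedAddCommGroup H] [InnerProductSpace ℂ H]

/-- The vectors `x` with `C^j x → 0`. -/
def stableSubmodule (C : H →L[ℂ] H) : Submodule ℂ H where
  carrier := {x | Tendsto (fun j : ℕ => (C ^ j) x) atTop (𝓝 0)}
  zero_mem' := by
    change Tendsto (fun j : ℕ => (C ^ j) 0) atTop (𝓝 0)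
    simp only [map_zero]
    exact tendsto_const_nhds
  add_mem' {x y} hx hy := by
    change Tendsto (fun j : ℕ => (C ^ j) (x + y)) atTop (𝓝 0)
    simpa only [map_add, add_zero] using Tendsto.add hx hy
  smul_mem' c x hx := by
    change Tendsto (fun j : ℕ => (C ^ j) (c • x)) atTop (𝓝 0)
    simpa only [map_smul, smul_zero] using Tendsto.const_smul hx c

theorem mem_stableSubmodule {C : H →L[ℂ] H} {x : H} :
    x ∈ stableSubmodule C ↔ Tendsto (fun j : ℕ => (C ^ j) x) atTop (𝓝 0) := Iff.rfl

theorem norm_pow_apply_le {C : H →L[ℂ] H} (hC : ‖C‖ ≤ 1) (j : ℕ) (x : H) :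
    ‖(C ^ j) x‖ ≤ ‖x‖ := by
  induction j with
  | zero => simp
  | succ j ih =>
    rw [pow_succ', mul_apply_eq_comp]
    exact ((C.le_of_opNorm_le hC _).trans_eq (one_mul _)).trans ih

theorem isClosed_stableSubmodule {C : H →L[ℂ] H} (hC : ‖C‖ ≤ 1) :
    IsClosed (stableSubmodule C : Set H) := by
  refine isClosed_of_closure_subset fun x hx => ?_
  rw [SetLike.mem_coe, mem_stableSubmodule, Metric.tendsto_atTop]
  intro ε hε
  obtain ⟨y, hy, hxy⟩ := Metric.mem_closure_iff.1 hx (ε / 2) (half_pos hε)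
  obtain ⟨N, hN⟩ := Metric.tendsto_atTop.1 (mem_stableSubmodule.1 hy) (ε / 2) (half_pos hε)
  refine ⟨N, fun j hj => ?_⟩
  have h1 := hN j hj
  have h2 := norm_pow_apply_le hC j (x - y)
  rw [dist_zero_right] at h1 ⊢
  rw [dist_eq_norm] at hxy
  have h3 : (C ^ j) x = (C ^ j) (x - y) + (C ^ j) y := by rw [map_sub, sub_add_cancel]
  rw [h3]
  linarith [norm_add_le ((C ^ j) (x - y)) ((C ^ j) y)]

theorem norm_star_le_one_of_star_mul_self [CompleteSpace H] {V : H →L[ℂ] H} (hV : star V * V = 1) :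
    ‖star V‖ ≤ 1 := by
  rw [norm_star]
  refine V.opNorm_le_bound zero_le_one fun x => ?_
  rw [one_mul]
  exact ((ContinuousLinearMap.norm_map_iff_adjoint_comp_self V).2 hV x).le

/-- If `C` is a contraction and `C x - q x` is stable for some `|q| < 1`, then `x` is stable: the
decreasing sequence `‖C^j x‖` has a limit `L` with `L ≤ |q| L`. -/
theorem mem_stableSubmodule_of_sub_smul_mem {C : H →L[ℂ] H} (hC : ‖C‖ ≤ 1) {q : ℂ} (hq : ‖q‖ < 1)
    {x : H} (hx : C x - q • x ∈ stableSubmodule C) : x ∈ stableSubmodule C := by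
  have hanti : Antitone fun j : ℕ => ‖(C ^ j) x‖ := antitone_nat_of_succ_le fun j => by
    rw [pow_succ', mul_apply_eq_comp]
    exact (C.le_of_opNorm_le hC _).trans_eq (one_mul _)
  have hlim := tendsto_atTop_ciInf hanti ⟨0, by rintro _ ⟨j, rfl⟩; exact norm_nonneg _⟩
  set L := ⨅ j : ℕ, ‖(C ^ j) x‖
  have hL0 : 0 ≤ L := ge_of_tendsto' hlim fun j => norm_nonneg _
  have hle : L ≤ ‖q‖ * L + 0 := by
    refine le_of_tendsto_of_tendsto' (hlim.comp (tendsto_add_atTop_nat 1))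
      ((hlim.const_mul ‖q‖).add (tendsto_zero_iff_norm_tendsto_zero.1 hx)) fun j => ?_
    have h : (C ^ (j + 1)) x = q • (C ^ j) x + (C ^ j) (C x - q • x) := by
      rw [pow_succ, mul_apply_eq_comp, map_sub, map_smul, add_sub_cancel]
    dsimp only [Function.comp_apply]
    rw [h, ← norm_smul]
    exact norm_add_le _ _
  have hL : L = 0 := by nlinarith
  rw [mem_stableSubmodule, tendsto_zero_iff_norm_tendsto_zero, ← hL]
  exact hlim

end Stable

section RegularPure

variable {S : Type*} [AddCommMonoid S] [IsCancelAdd S]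

/-- `π(a)` is pure as soon as no element of `S` is divisible by all multiples of `a`. -/
theorem tendsto_star_regularRep_pow {a : S} (ha : ∀ b : S, ∃ j : ℕ, ¬∃ c, j • a + c = b)
    (f : lp (fun _ : S => ℂ) 2) :
    Tendsto (fun j : ℕ => (star (regularRep a) ^ j) f) atTop (𝓝 0) := by
  classical
  have hC := norm_star_le_one_of_star_mul_self (star_regularRep_mul_self a)
  have hs : ∀ (b : S) (z : ℂ), lp.single 2 b z ∈ stableSubmodule (star (regularRep a)) := by
    intro b z
    obtain ⟨N, hN⟩ := ha b
    refine tendsto_const_nhds.congr' ?_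
    filter_upwards [eventually_ge_atTop N] with j hj
    obtain ⟨m, rfl⟩ := Nat.exists_eq_add_of_le hj
    ext d
    rw [← star_pow, ← regularRep_nsmul, star_regularRep_apply, lp.single_apply_ne]
    · rfl
    · intro h
      exact hN ⟨m • a + d, by rw [← h, add_nsmul, add_assoc]⟩
  exact (isClosed_stableSubmodule hC).mem_of_tendsto (lp.hasSum_single (by norm_num) f)
    (.of_forall fun s => Submodule.sum_mem _ fun b _ => hs b (f b))

end RegularPure

/-! ### The operators `T_{Φ_t}` -/

theorem singularInnerOp_ext {A B : HardySpace →L[ℂ] HardySpace}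
    (h : ∀ f, HardySpace.incl (A f) =ᵐ[haarAddCircle] HardySpace.incl (B f)) : A = B := by
  ext f
  exact HardySpace.incl.injective (Lp.ext (h f))

theorem singularInner_add (s t : ℝ) (x : AddCircle (2 * π)) :
    singularInner (s + t) x = singularInner s x * singularInner t x := by
  simp only [singularInner, singularFun]
  rw [← Complex.exp_add, Complex.ofReal_add, add_mul]

theorem singularInnerOp_zero : singularInnerOp 0 = 1 := by
  refine singularInnerOp_ext fun f => ?_
  filter_upwards [coeFn_singularInnerOp 0 f] with x hx
  rw [hx]
  simp [singularInner, singularFun]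

theorem singularInnerOp_add (s t : ℝ≥0) :
    singularInnerOp (s + t) = singularInnerOp s * singularInnerOp t := by
  refine singularInnerOp_ext fun f => ?_
  filter_upwards [coeFn_singularInnerOp (s + t) f, coeFn_singularInnerOp t f,
    coeFn_singularInnerOp s (singularInnerOp t f)] with x h1 h2 h3
  rw [mul_apply_eq_comp, h1, h3, h2, NNReal.coe_add, singularInner_add, mul_assoc]

theorem singularInnerOp_nsmul (m : ℕ) (t : ℝ≥0) :
    singularInnerOp (m • t) = singularInnerOp t ^ m := by
  induction m with
  | zero => rw [zero_nsmul, pow_zero, singularInnerOp_zero]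
  | succ m ih => rw [succ_nsmul, pow_succ, singularInnerOp_add, ih]

/-- Pointwise, and also at `θ = 0`: there the quotient in the exponent has the junk value `0`. -/
theorem norm_singularInner (t : ℝ) (x : AddCircle (2 * π)) : ‖singularInner t x‖ = 1 := by
  set z : ℂ := fourier 1 x with hz
  have h1 : Complex.normSq z = 1 := by
    rw [Complex.normSq_eq_norm_sq, hz, norm_fourier_apply, one_pow]
  have hre : ((z + 1) / (z - 1)).re = 0 := by
    rw [Complex.normSq_apply] at h1
    rw [Complex.div_re, ← add_div, div_eq_zero_iff]
    left
    simp
    linarith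
  rw [singularInner, singularFun, Complex.norm_exp, Complex.re_ofReal_mul, ← hz, hre, mul_zero,
    Real.exp_zero]

theorem star_singularInnerOp_mul_self (t : ℝ≥0) :
    star (singularInnerOp t) * singularInnerOp t = 1 := by
  refine (ContinuousLinearMap.norm_map_iff_adjoint_comp_self _).1 fun f => ?_
  rw [← HardySpace.incl.norm_map, ← HardySpace.incl.norm_map f, Lp.norm_def, Lp.norm_def]
  congr 1
  refine eLpNorm_congr_norm_ae ?_
  filter_upwards [coeFn_singularInnerOp t f] with x hx
  rw [hx, norm_mul, norm_singularInner, one_mul]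

/-- The function `e^{ikθ}` as an element of `H²`. -/
noncomputable def hardyMonomial (k : ℕ) : HardySpace := ⟨fourierLp 2 (k : ℤ), fourierLp_mem_hardySubmodule k⟩

theorem incl_hardyMonomial (k : ℕ) :
    HardySpace.incl (hardyMonomial k) = fourierLp 2 (k : ℤ) := rfl

theorem inner_hardyMonomial (k l : ℕ) :
    inner ℂ (hardyMonomial k) (hardyMonomial l) = if k = l then (1 : ℂ) else 0 := by
  rw [← HardySpace.incl.inner_map_map, incl_hardyMonomial, incl_hardyMonomial,
    orthonormal_iff_ite.1 orthonormal_fourier]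
  simp

theorem mem_of_hardyMonomial_mem {N : Submodule ℂ HardySpace} (hN : IsClosed (N : Set HardySpace))
    (h : ∀ k, hardyMonomial k ∈ N) (f : HardySpace) : f ∈ N := by
  have hmap : hardySubmodule ≤ N.map HardySpace.incl.toLinearMap := by
    refine Submodule.topologicalClosure_minimal _ (Submodule.span_le.2 ?_) ?_
    · rintro _ ⟨k, rfl⟩
      exact ⟨hardyMonomial k, h k, rfl⟩
    · exact HardySpace.incl.isometry.isClosedEmbedding.isClosedMap _ hN
  obtain ⟨g, hg, hgf⟩ := hmap f.2
  rwa [← HardySpace.incl.injective (hgf : HardySpace.incl g = HardySpace.incl f)]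

theorem inner_singularInnerOp_hardyMonomial (t : ℝ≥0) (k l : ℕ) :
    inner ℂ (hardyMonomial k) (singularInnerOp t (hardyMonomial l)) =
      fourierCoeff (singularInner t) (k - l : ℤ) := by
  rw [← HardySpace.incl.inner_map_map, L2.inner_def, fourierCoeff]
  refine integral_congr_ae ?_
  filter_upwards [coeFn_singularInnerOp t (hardyMonomial l), coeFn_fourierLp 2 (k : ℤ),
    coeFn_fourierLp 2 (l : ℤ)] with x h1 h2 h3
  rw [h1, incl_hardyMonomial, incl_hardyMonomial, h2, h3, neg_sub, sub_eq_add_neg, fourier_add,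
    fourier_neg, RCLike.inner_apply, smul_eq_mul]
  ring

/-- `Φ_t` lies in `H²`, which is orthogonal to the `e^{imθ}` with `m < 0`. -/
theorem fourierCoeff_singularInner_of_neg (t : ℝ≥0) {m : ℤ} (hm : m < 0) :
    fourierCoeff (singularInner t) m = 0 := by
  have h : ∀ f ∈ hardySubmodule, inner ℂ (fourierLp 2 m : L2Circle) f = 0 := by
    intro f hf
    have hle : hardySubmodule ≤ (ℂ ∙ (fourierLp 2 m : L2Circle))ᗮ := by
      refine Submodule.topologicalClosure_minimal _ (Submodule.span_le.2 ?_)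
        (Submodule.isClosed_orthogonal _)
      rintro _ ⟨k, rfl⟩
      rw [SetLike.mem_coe, Submodule.mem_orthogonal_singleton_iff_inner_right,
        orthonormal_iff_ite.1 orthonormal_fourier, if_neg (by omega)]
    exact Submodule.mem_orthogonal_singleton_iff_inner_right.1 (hle hf)
  rw [← h _ (mulSingularInner_fourier_mem t 0), L2.inner_def, fourierCoeff]
  refine integral_congr_ae ?_
  filter_upwards [coeFn_mulSingularInner t (fourierLp 2 ((0 : ℕ) : ℤ)), coeFn_fourierLp 2 m,
    coeFn_fourierLp 2 ((0 : ℕ) : ℤ)] with x h1 h2 h3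
  rw [h1, h2, h3, fourier_neg, RCLike.inner_apply, smul_eq_mul]
  simp [mul_comm]

/-- The mean value property on the circle of radius `r < 1`. -/
theorem integral_singularFun_dilate (t : ℝ) {r : ℝ} (h0 : 0 ≤ r) (h1 : r < 1) :
    ∫ x : AddCircle (2 * π), singularFun t (r * fourier 1 x) ∂haarAddCircle =
      Complex.exp (-t) := by
  have hd : DiffContOnCl ℂ (singularFun t) (Metric.ball 0 |r|) := by
    refine ((differentiableOn_singularFun t).mono ?_).diffContOnCl
    refine Metric.closure_ball_subset_closedBall.trans (Metric.closedBall_subset_ball ?_)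
    rwa [abs_of_nonneg h0]
  have hm := hd.circleAverage
  have hc := fourierCoeff_eq_intervalIntegral
    (fun x : AddCircle (2 * π) => singularFun t (r * fourier 1 x)) 0 0
  rw [fourierCoeff] at hc
  simp only [neg_zero, fourier_zero, one_smul, zero_add] at hc
  rw [hc]
  have h00 : singularFun t 0 = Complex.exp (-t) := by simp [singularFun]
  rw [← h00, ← hm, Real.circleAverage_def, one_div]
  congr 1
  refine intervalIntegral.integral_congr fun θ _ => ?_
  rw [fourier_coe_apply, circleMap, zero_add]
  congr 3
  have : (π : ℂ) ≠ 0 := by exact_mod_cast Real.pi_ne_zero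
  push_cast
  field_simp

/-- The mean value property on the circles of radius `r < 1`, in the limit `r → 1`. -/
theorem fourierCoeff_singularInner_zero (t : ℝ≥0) :
    fourierCoeff (singularInner t) 0 = Complex.exp (-t) := by
  set r : ℕ → ℝ := fun m => 1 - 1 / ((m : ℝ) + 1) with hr
  have hr1 : ∀ m, r m < 1 := fun m => by
    have : (0 : ℝ) < 1 / ((m : ℝ) + 1) := by positivity
    simp only [hr]; linarith
  have hr0 : ∀ m, 0 ≤ r m := fun m => by
    simp only [hr, sub_nonneg]
    rw [div_le_one (by positivity)]
    linarith [(Nat.cast_nonneg m : (0 : ℝ) ≤ m)]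
  have hrlim : Tendsto r atTop (𝓝 1) := by
    simpa [hr] using
      (tendsto_const_nhds (x := (1 : ℝ))).sub (tendsto_one_div_add_atTop_nhds_zero_nat (𝕜 := ℝ))
  have hlim : Tendsto (fun m => ∫ x : AddCircle (2 * π), singularFun t (r m * fourier 1 x)
      ∂haarAddCircle) atTop (𝓝 (∫ x, singularInner t x ∂haarAddCircle)) := by
    refine tendsto_integral_of_dominated_convergence (fun _ => 1) (fun m => ?_)
      (integrable_const 1) (fun m => .of_forall fun x => ?_) ?_
    · have : Measurable fun x : AddCircle (2 * π) => (fourier 1 x : ℂ) :=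
        (fourier (T := 2 * π) 1).continuous.measurable
      refine Measurable.aestronglyMeasurable ?_
      unfold singularFun
      fun_prop
    · refine norm_singularFun_le t.2 ?_
      rw [norm_mul, norm_fourier_apply, mul_one, Complex.norm_real, Real.norm_of_nonneg (hr0 m)]
      exact (hr1 m).le
    · filter_upwards [ae_fourier_ne_one] with x hx
      have hc : ContinuousAt (singularFun t) (fourier 1 x) := by
        have : (fourier 1 x : ℂ) - 1 ≠ 0 := sub_ne_zero.2 hx
        unfold singularFun
        fun_prop (disch := assumption)
      refine hc.tendsto.comp ?_
      have : Tendsto (fun m => (r m : ℂ)) atTop (𝓝 ((1 : ℝ) : ℂ)) :=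
        (Complex.continuous_ofReal.tendsto 1).comp hrlim
      simpa using this.mul_const (fourier 1 x : ℂ)
  simp only [integral_singularFun_dilate t (hr0 _) (hr1 _)] at hlim
  rw [fourierCoeff]
  simpa using tendsto_nhds_unique hlim tendsto_const_nhds

theorem norm_exp_neg_lt_one {t : ℝ≥0} (ht : 0 < t) : ‖Complex.exp (-t)‖ < 1 := by
  rw [Complex.norm_exp]
  simpa using ht

/-- `T_{Φ_t}*` is upper triangular in the basis `e^{ikθ}`, with the diagonal entries `e^{-t}`. -/
theorem star_singularInnerOp_hardyMonomial (t : ℝ≥0) (k : ℕ) :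
    star (singularInnerOp t) (hardyMonomial k) - Complex.exp (-t) • hardyMonomial k ∈
      Submodule.span ℂ (hardyMonomial '' Set.Iio k) := by
  set C := star (singularInnerOp t) with hC
  have hcoef : ∀ l, inner ℂ (hardyMonomial l) (C (hardyMonomial k)) =
      starRingEnd ℂ (fourierCoeff (singularInner t) (k - l : ℤ)) := fun l => by
    rw [← inner_singularInnerOp_hardyMonomial, inner_conj_symm, inner_apply_right_eq, hC, star_star]
  have hdiag : starRingEnd ℂ (Complex.exp (-t)) = Complex.exp (-t) := by
    rw [← Complex.exp_conj]; simp
  set y := ∑ l ∈ Finset.range k, inner ℂ (hardyMonomial l) (C (hardyMonomial k)) •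
    hardyMonomial l with hy
  suffices h : C (hardyMonomial k) - Complex.exp (-t) • hardyMonomial k = y by
    rw [h, hy]
    refine Submodule.sum_mem _ fun l hl => Submodule.smul_mem _ _ (Submodule.subset_span ?_)
    exact ⟨l, Finset.mem_range.1 hl, rfl⟩
  -- The difference of the two sides is orthogonal to every monomial.
  set u := C (hardyMonomial k) - Complex.exp (-t) • hardyMonomial k - y with hu
  suffices h : u = 0 from sub_eq_zero.1 h
  have hmem : ∀ f : HardySpace, f ∈ (ℂ ∙ u)ᗮ := by
    refine mem_of_hardyMonomial_mem (Submodule.isClosed_orthogonal _) fun m => ?_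
    rw [Submodule.mem_orthogonal_singleton_iff_inner_left, hu, inner_sub_right, inner_sub_right,
      inner_smul_right, inner_hardyMonomial, hy, inner_sum]
    simp only [inner_smul_right, inner_hardyMonomial, mul_ite, mul_one, mul_zero,
      Finset.sum_ite_eq, Finset.mem_range]
    rcases lt_trichotomy m k with h | h | h
    · simp [h, h.ne]
    · subst h
      simp [hcoef, fourierCoeff_singularInner_zero, hdiag]
    · rw [if_neg h.ne', if_neg h.not_gt, hcoef,
        fourierCoeff_singularInner_of_neg t (by omega)]
      simp
  have := Submodule.mem_orthogonal_singleton_iff_inner_right.1 (hmem u)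
  exact inner_self_eq_zero.1 this

theorem tendsto_star_singularInnerOp_pow {t : ℝ≥0} (ht : 0 < t) (f : HardySpace) :
    Tendsto (fun j : ℕ => (star (singularInnerOp t) ^ j) f) atTop (𝓝 0) := by
  have hC := norm_star_le_one_of_star_mul_self (star_singularInnerOp_mul_self t)
  refine mem_of_hardyMonomial_mem (isClosed_stableSubmodule hC) (fun k => ?_) f
  induction k using Nat.strong_induction_on with
  | _ k ih =>
    refine mem_stableSubmodule_of_sub_smul_mem hC (norm_exp_neg_lt_one ht) ?_
    refine Submodule.span_le.2 ?_ (star_singularInnerOp_hardyMonomial t k)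
    rintro _ ⟨l, hl, rfl⟩
    exact ih l hl

/-- `T_{Φ_t}` is not unitary: as `T_{Φ_t}* 1 = e^{-t}`, the vector `1 - T_{Φ_t} T_{Φ_t}* 1` of the
kernel of the adjoint is not zero. -/
theorem exists_unit_star_singularInnerOp_eq_zero {t : ℝ≥0} (ht : 0 < t) :
    ∃ e : HardySpace, ‖e‖ = 1 ∧ star (singularInnerOp t) e = 0 := by
  set V := singularInnerOp t with hVdef
  have hV := star_singularInnerOp_mul_self t
  set y := hardyMonomial 0 - V (star V (hardyMonomial 0)) with hy
  have hker : star V y = 0 := by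
    rw [hy, map_sub, ← mul_apply_eq_comp (star V) V, hV, one_apply_eq_self, sub_self]
  have heig : star V (hardyMonomial 0) = Complex.exp (-t) • hardyMonomial 0 := by
    simpa [sub_eq_zero] using star_singularInnerOp_hardyMonomial t 0
  have hne : y ≠ 0 := by
    intro h0
    have h1 : ‖hardyMonomial 0‖ = 1 := by
      rw [← HardySpace.incl.norm_map, incl_hardyMonomial]
      exact orthonormal_fourier.1 _
    have h2 : ‖V (star V (hardyMonomial 0))‖ = 1 := by rw [← sub_eq_zero.1 h0, h1]
    rw [(ContinuousLinearMap.norm_map_iff_adjoint_comp_self V).2 hV, heig, norm_smul, h1,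
      mul_one] at h2
    exact (norm_exp_neg_lt_one ht).ne h2
  refine ⟨((‖y‖⁻¹ : ℝ) : ℂ) • y, ?_, by rw [map_smul, hker, smul_zero]⟩
  rw [norm_smul, Complex.norm_real, norm_inv, norm_norm, inv_mul_cancel₀ (norm_ne_zero_iff.2 hne)]

/-! ### From norm equalities to isomorphisms of generated `C*`-algebras -/

/-- If the two coordinates of every element of a `*`-subalgebra `R ⊆ A × B` have the same norm,
then the closures of the two projections of `R` are isomorphic. -/
theorem nonempty_starAlgEquiv_of_norm_eq {A B : Type*} [CStarAlgebra A] [CStarAlgebra B]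
    (R : StarSubalgebra ℂ (A × B)) (hR : ∀ x ∈ R, ‖x.1‖ = ‖x.2‖) (L : StarSubalgebra ℂ A)
    (M : StarSubalgebra ℂ B) (hL : L = (R.map (StarAlgHom.fst ℂ A B)).topologicalClosure)
    (hM : M = (R.map (StarAlgHom.snd ℂ A B)).topologicalClosure) : Nonempty (L ≃⋆ₐ[ℂ] M) := by
  have hLc : IsClosed (L : Set A) := hL ▸ StarSubalgebra.isClosed_topologicalClosure _
  have hMc : IsClosed (M : Set B) := hM ▸ StarSubalgebra.isClosed_topologicalClosure _
  have h1 : ∀ x ∈ R, x.1 ∈ L := fun x hx =>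
    hL ▸ StarSubalgebra.le_topologicalClosure _ (StarSubalgebra.mem_map.2 ⟨x, hx, rfl⟩)
  have h2 : ∀ x ∈ R, x.2 ∈ M := fun x hx =>
    hM ▸ StarSubalgebra.le_topologicalClosure _ (StarSubalgebra.mem_map.2 ⟨x, hx, rfl⟩)
  let U : StarSubalgebra ℂ (L × M) := R.comap
    ((L.subtype.comp (StarAlgHom.fst ℂ L M)).prod (M.subtype.comp (StarAlgHom.snd ℂ L M)))
  refine nonempty_starAlgEquiv_of_graph U.toNonUnitalStarSubalgebra
    (fun x hx => (hR _ hx).symm) (fun a => ?_) fun b => ?_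
  · rw [closure_subtype]
    have ha : (a : A) ∈ (R.map (StarAlgHom.fst ℂ A B)).topologicalClosure := hL ▸ a.2
    refine closure_mono ?_ ha
    rintro _ ⟨x, hx, rfl⟩
    exact ⟨⟨x.1, h1 x hx⟩, ⟨(⟨x.1, h1 x hx⟩, ⟨x.2, h2 x hx⟩), hx, rfl⟩, rfl⟩
  · rw [closure_subtype]
    have hb : (b : B) ∈ (R.map (StarAlgHom.snd ℂ A B)).topologicalClosure := hM ▸ b.2
    refine closure_mono ?_ hb
    rintro _ ⟨x, hx, rfl⟩
    exact ⟨⟨x.2, h2 x hx⟩, ⟨(⟨x.1, h1 x hx⟩, ⟨x.2, h2 x hx⟩), hx, rfl⟩, rfl⟩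

/-- Coburn's theorem for two pure isometries, neither of them unitary. -/
theorem norm_fst_eq_norm_snd_of_mem_adjoin {H G : Type*} [NormedAddCommGroup H]
    [InnerProductSpace ℂ H] [CompleteSpace H] [NormedAddCommGroup G] [InnerProductSpace ℂ G]
    [CompleteSpace G] {V : H →L[ℂ] H} {V' : G →L[ℂ] G}
    (hV : star V * V = 1) (hp : ∀ x, Tendsto (fun j : ℕ => (star V ^ j) x) atTop (𝓝 0))
    (hk : ∃ e : H, ‖e‖ = 1 ∧ star V e = 0)
    (hV' : star V' * V' = 1) (hp' : ∀ x, Tendsto (fun j : ℕ => (star V' ^ j) x) atTop (𝓝 0))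
    (hk' : ∃ e : G, ‖e‖ = 1 ∧ star V' e = 0)
    {x : (H →L[ℂ] H) × (G →L[ℂ] G)} (hx : x ∈ StarAlgebra.adjoin ℂ {(V, V')}) :
    ‖x.1‖ = ‖x.2‖ := by
  obtain ⟨e, he, hke⟩ := hk
  obtain ⟨e', he', hke'⟩ := hk'
  refine le_antisymm (norm_fst_le_norm_snd_of_mem_adjoin hV hp hV' he' hke' hx) ?_
  have hswap : x.swap ∈ StarAlgebra.adjoin ℂ {(V', V)} := by
    have h : (StarAlgebra.adjoin ℂ {(V, V')}).map ((StarAlgHom.snd ℂ _ _).prod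
        (StarAlgHom.fst ℂ (H →L[ℂ] H) (G →L[ℂ] G))) = StarAlgebra.adjoin ℂ {(V', V)} := by
      rw [StarAlgHom.map_adjoin, Set.image_singleton]
      rfl
    rw [← h]
    exact StarSubalgebra.mem_map.2 ⟨x, hx, rfl⟩
  exact norm_fst_le_norm_snd_of_mem_adjoin hV' hp' hV he hke hswap

/-! ### The `n`-adic rationals -/

theorem exists_int_div_of_mem_nAdicRationals {n : ℕ} (hn : 0 < n) {q : ℚ}
    (hq : q ∈ nAdicRationals n) : ∃ (m : ℤ) (k : ℕ), q = (m : ℚ) / (n : ℚ) ^ k := by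
  have hn' : (n : ℚ) ≠ 0 := by exact_mod_cast hn.ne'
  induction hq using AddSubmonoid.closure_induction with
  | mem q hq => exact hq
  | zero => exact ⟨0, 0, by simp⟩
  | add p q _ _ hp hq =>
    obtain ⟨m, k, rfl⟩ := hp
    obtain ⟨m', k', rfl⟩ := hq
    refine ⟨m * n ^ k' + m' * n ^ k, k + k', ?_⟩
    push_cast
    field_simp
    ring

/-- The element `1 / n^k` of `ℚ^(n)_+`. -/
def nAdicUnit (n k : ℕ) : nAdicNonneg n :=
  ⟨1 / (n : ℚ) ^ k, by
    refine ⟨?_, AddSubmonoid.subset_closure ⟨1, k, by simp⟩⟩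
    rw [SetLike.mem_coe, AddSubmonoid.mem_nonneg]
    positivity⟩

theorem coe_nAdicUnit (n k : ℕ) : (nAdicUnit n k : ℚ) = 1 / (n : ℚ) ^ k := rfl

theorem coe_nAdicNonneg_nonneg {n : ℕ} (q : nAdicNonneg n) : (0 : ℚ) ≤ q := q.2.1

theorem nAdicUnit_pos {n : ℕ} (hn : 0 < n) (k : ℕ) : (0 : ℚ) < nAdicUnit n k := by
  rw [coe_nAdicUnit]
  positivity

theorem exists_eq_nsmul_nAdicUnit {n : ℕ} (hn : 0 < n) (q : nAdicNonneg n) :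
    ∃ m k : ℕ, q = m • nAdicUnit n k := by
  obtain ⟨m, k, h⟩ := exists_int_div_of_mem_nAdicRationals hn q.2.2
  have hpos : (0 : ℚ) < (n : ℚ) ^ k := by positivity
  have hm : 0 ≤ m := by
    have h0 := coe_nAdicNonneg_nonneg q
    rw [h, le_div_iff₀ hpos, zero_mul] at h0
    exact_mod_cast h0
  lift m to ℕ using hm
  refine ⟨m, k, Subtype.ext ?_⟩
  rw [h, AddSubmonoidClass.coe_nsmul, coe_nAdicUnit, nsmul_eq_mul, mul_one_div]
  rfl

theorem nsmul_nAdicUnit_succ {n : ℕ} (hn : 0 < n) (k : ℕ) :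
    n • nAdicUnit n (k + 1) = nAdicUnit n k := by
  have hn' : (n : ℚ) ≠ 0 := by exact_mod_cast hn.ne'
  refine Subtype.ext ?_
  rw [AddSubmonoidClass.coe_nsmul, coe_nAdicUnit, coe_nAdicUnit, nsmul_eq_mul, pow_succ]
  field_simp

theorem tendsto_star_regularRep_nAdicUnit_pow {n : ℕ} (hn : 0 < n) (k : ℕ)
    (f : lp (fun _ : nAdicNonneg n => ℂ) 2) :
    Tendsto (fun j : ℕ => (star (regularRep (nAdicUnit n k)) ^ j) f) atTop (𝓝 0) := by
  refine tendsto_star_regularRep_pow (fun b => ?_) f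
  obtain ⟨j, hj⟩ := exists_lt_nsmul (nAdicUnit_pos hn k) (b : ℚ)
  refine ⟨j, ?_⟩
  rintro ⟨c, rfl⟩
  rw [AddSubmonoid.coe_add, AddSubmonoidClass.coe_nsmul] at hj
  linarith [coe_nAdicNonneg_nonneg c]

theorem exists_unit_star_regularRep_eq_zero {n : ℕ} (hn : 0 < n) (k : ℕ) :
    ∃ e : lp (fun _ : nAdicNonneg n => ℂ) 2,
      ‖e‖ = 1 ∧ star (regularRep (nAdicUnit n k)) e = 0 := by
  refine ⟨lp.single 2 0 1, by rw [lp.norm_single (by norm_num), norm_one], ?_⟩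
  ext d
  rw [star_regularRep_apply, lp.single_apply_ne]
  · rfl
  · intro h
    have h' := congrArg (Subtype.val : nAdicNonneg n → ℚ) h
    rw [AddSubmonoid.coe_add] at h'
    have h0 : ((0 : nAdicNonneg n) : ℚ) = 0 := rfl
    linarith [coe_nAdicNonneg_nonneg d, nAdicUnit_pos hn k]

/-! ### The tower of Toeplitz algebras -/

theorem nsmul_one_div_pow_succ {n : ℕ} (hn : 0 < n) (k : ℕ) :
    n • (1 / (n : ℝ≥0) ^ (k + 1)) = 1 / (n : ℝ≥0) ^ k := by
  have hn' : (n : ℝ≥0) ≠ 0 := by exact_mod_cast hn.ne'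
  rw [nsmul_eq_mul, pow_succ]
  field_simp

theorem toeplitzAlgebra_le_succ {n : ℕ} (hn : 0 < n) (k : ℕ) :
    toeplitzAlgebra (1 / (n : ℝ≥0) ^ k) ≤ toeplitzAlgebra (1 / (n : ℝ≥0) ^ (k + 1)) := by
  refine StarAlgebra.elemental.le_of_mem (isClosed_toeplitzAlgebra _) ?_
  rw [← nsmul_one_div_pow_succ hn k, singularInnerOp_nsmul]
  exact pow_mem (StarAlgebra.elemental.self_mem ℂ _) n

/-- The generators `T_{Φ_{1/n^k}}` and `π(1/n^k)` of the two algebras, side by side. -/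
noncomputable def towerGenerator (n k : ℕ) : (HardySpace →L[ℂ] HardySpace) ×
    (lp (fun _ : nAdicNonneg n => ℂ) 2 →L[ℂ] lp (fun _ : nAdicNonneg n => ℂ) 2) :=
  (singularInnerOp (1 / (n : ℝ≥0) ^ k), regularRep (nAdicUnit n k))

theorem towerGenerator_succ_pow {n : ℕ} (hn : 0 < n) (k : ℕ) :
    towerGenerator n (k + 1) ^ n = towerGenerator n k := by
  refine Prod.ext ?_ ?_
  · rw [Prod.pow_fst, towerGenerator, towerGenerator, ← singularInnerOp_nsmul,
      nsmul_one_div_pow_succ hn]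
  · rw [Prod.pow_snd, towerGenerator, towerGenerator, ← regularRep_nsmul, nsmul_nAdicUnit_succ hn]

theorem norm_fst_eq_norm_snd_of_mem_adjoin_towerGenerator {n : ℕ} (hn : 0 < n)
    {x : (HardySpace →L[ℂ] HardySpace) ×
      (lp (fun _ : nAdicNonneg n => ℂ) 2 →L[ℂ] lp (fun _ : nAdicNonneg n => ℂ) 2)}
    (hx : x ∈ StarAlgebra.adjoin ℂ (Set.range (towerGenerator n))) : ‖x.1‖ = ‖x.2‖ := by
  -- Each generator is a power of the next, so `x` is a polynomial in a single one of them.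
  have hmono : Monotone fun k => StarAlgebra.adjoin ℂ {towerGenerator n k} := by
    refine monotone_nat_of_le_succ fun k => StarAlgebra.adjoin_le ?_
    rw [Set.singleton_subset_iff, ← towerGenerator_succ_pow hn k]
    exact pow_mem (StarAlgebra.self_mem_adjoin_singleton ℂ _) n
  have hex : ∃ k, x ∈ StarAlgebra.adjoin ℂ {towerGenerator n k} := by
    induction hx using StarAlgebra.adjoin_induction with
    | mem x hx =>
      obtain ⟨k, rfl⟩ := hx
      exact ⟨k, StarAlgebra.self_mem_adjoin_singleton ℂ _⟩
    | algebraMap r => exact ⟨0, algebraMap_mem _ r⟩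
    | add x y _ _ hx hy =>
      obtain ⟨k, hk⟩ := hx
      obtain ⟨l, hl⟩ := hy
      exact ⟨max k l, add_mem (hmono (le_max_left k l) hk) (hmono (le_max_right k l) hl)⟩
    | mul x y _ _ hx hy =>
      obtain ⟨k, hk⟩ := hx
      obtain ⟨l, hl⟩ := hy
      exact ⟨max k l, mul_mem (hmono (le_max_left k l) hk) (hmono (le_max_right k l) hl)⟩
    | star x _ hx =>
      obtain ⟨k, hk⟩ := hx
      exact ⟨k, star_mem hk⟩
  obtain ⟨k, hk⟩ := hex
  have ht : (0 : ℝ≥0) < 1 / (n : ℝ≥0) ^ k := by positivity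
  exact norm_fst_eq_norm_snd_of_mem_adjoin (star_singularInnerOp_mul_self _)
    (tendsto_star_singularInnerOp_pow ht) (exists_unit_star_singularInnerOp_eq_zero ht)
    (star_regularRep_mul_self _) (tendsto_star_regularRep_nAdicUnit_pow hn k)
    (exists_unit_star_regularRep_eq_zero hn k) hk

theorem toeplitzTowerAlgebra_eq (n : ℕ) :
    toeplitzTowerAlgebra n = ((StarAlgebra.adjoin ℂ (Set.range (towerGenerator n))).map
      (StarAlgHom.fst ℂ _ _)).topologicalClosure := by
  rw [StarAlgHom.map_adjoin, ← Set.range_comp]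
  refine le_antisymm ?_ ?_
  · refine StarSubalgebra.topologicalClosure_minimal (iSup_le fun k => ?_)
      (StarSubalgebra.isClosed_topologicalClosure _)
    refine StarAlgebra.elemental.le_of_mem (StarSubalgebra.isClosed_topologicalClosure _) ?_
    exact StarSubalgebra.le_topologicalClosure _ (StarAlgebra.subset_adjoin ℂ _ ⟨k, rfl⟩)
  · refine StarSubalgebra.topologicalClosure_minimal (StarAlgebra.adjoin_le ?_)
      (isClosed_toeplitzTowerAlgebra n)
    rintro _ ⟨k, rfl⟩
    exact toeplitzAlgebra_le_tower n k (StarAlgebra.elemental.self_mem ℂ _)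

theorem reducedCStarAlgebra_nAdicNonneg_eq {n : ℕ} (hn : 0 < n) :
    reducedCStarAlgebra (nAdicNonneg n) =
      ((StarAlgebra.adjoin ℂ (Set.range (towerGenerator n))).map
        (StarAlgHom.snd ℂ _ _)).topologicalClosure := by
  rw [StarAlgHom.map_adjoin, ← Set.range_comp, reducedCStarAlgebra]
  congr 1
  refine le_antisymm (StarAlgebra.adjoin_le ?_) (StarAlgebra.adjoin_mono ?_)
  · rintro _ ⟨q, rfl⟩
    obtain ⟨m, k, rfl⟩ := exists_eq_nsmul_nAdicUnit hn q
    rw [regularRep_nsmul]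
    refine pow_mem (StarAlgebra.subset_adjoin ℂ _ ?_) m
    exact ⟨k, rfl⟩
  · rintro _ ⟨k, rfl⟩
    exact ⟨nAdicUnit n k, rfl⟩

theorem mem_closure_iUnion_range_inclusion {n : ℕ} (hn : 0 < n) (x : toeplitzTowerAlgebra n) :
    x ∈ closure (⋃ k, Set.range (StarSubalgebra.inclusion (toeplitzAlgebra_le_tower n k))) := by
  rw [closure_subtype]
  refine closure_mono ?_ x.2
  have hdir : Directed (· ≤ ·) fun k : ℕ => toeplitzAlgebra (1 / (n : ℝ≥0) ^ k) :=
    (monotone_nat_of_le_succ (toeplitzAlgebra_le_succ hn)).directed_le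
  rw [StarSubalgebra.coe_iSup_of_directed hdir]
  refine Set.iUnion_subset fun k a ha => ?_
  exact ⟨⟨a, toeplitzAlgebra_le_tower n k ha⟩, Set.mem_iUnion.2 ⟨k, ⟨a, ha⟩, rfl⟩, rfl⟩

/-- Stated for an abstract `C*`-algebra, where the equality is definitional at no cost; unfolding the
operators on `H²` to check it there is expensive. -/
theorem coe_inclusion_comp_coe_inclusion {A : Type*} [CStarAlgebra A] {K L M : StarSubalgebra ℂ A}
    (h : K ≤ L) (h' : L ≤ M) (h'' : K ≤ M) :
    ((StarSubalgebra.inclusion h' : L →⋆ₐ[ℂ] M) : L →⋆ₙₐ[ℂ] M).comp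
      ((StarSubalgebra.inclusion h : K →⋆ₐ[ℂ] L) : K →⋆ₙₐ[ℂ] L) =
    ((StarSubalgebra.inclusion h'' : K →⋆ₐ[ℂ] M) : K →⋆ₙₐ[ℂ] M) := rfl

theorem mainTheorem6 (n : ℕ) (hn : 0 < n) :
    ∃ h : ∀ k : ℕ, toeplitzAlgebra (1 / (n : ℝ≥0) ^ k) ≤ toeplitzAlgebra (1 / (n : ℝ≥0) ^ (k + 1)),
      IsInductiveLimit.{0, 0, w}
        (fun k : ℕ => (StarSubalgebra.inclusion (h k) :
          toeplitzAlgebra (1 / (n : ℝ≥0) ^ k) →⋆ₙₐ[ℂ] toeplitzAlgebra (1 / (n : ℝ≥0) ^ (k + 1))))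
        (fun k : ℕ => (StarSubalgebra.inclusion (toeplitzAlgebra_le_tower n k) :
          toeplitzAlgebra (1 / (n : ℝ≥0) ^ k) →⋆ₙₐ[ℂ] toeplitzTowerAlgebra n)) ∧
      Nonempty (toeplitzTowerAlgebra n ≃⋆ₐ[ℂ] reducedCStarAlgebra (nAdicNonneg n)) := by
  refine ⟨toeplitzAlgebra_le_succ hn, ?_, ?_⟩
  · exact isInductiveLimit_of_dense _ _
      (fun k => StarSubalgebra.inclusion_injective (toeplitzAlgebra_le_tower n k)) (fun k => coe_inclusion_comp_coe_inclusion _ _ _)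
      (mem_closure_iUnion_range_inclusion hn)
  · exact nonempty_starAlgEquiv_of_norm_eq _
      (fun x hx => norm_fst_eq_norm_snd_of_mem_adjoin_towerGenerator hn hx) _ _
      (toeplitzTowerAlgebra_eq n) (reducedCStarAlgebra_nAdicNonneg_eq hn)
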